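/- Let $K$ be a nonempty pathwise connected poset. A $1$-simplex $b$ of $K$ from $a=\partial_1 b$ to $o=\partial_0 b$ is given by a support $|b|\in K$ with $a,o\le |b|$; its opposite $\overline b$ has the same support and runs from $o$ to $a$; for $a\le o$, $(oa)$ is the $1$-simplex from $a$ to $o$ with support $o$. A path is a composable word $p=b_n*\cdots*b_1$, $n\ge 1$, of $1$-simplices; $K$ is pathwise connected if any two elements are joined by a path. Homotopy $\sim$ of paths is generated by replacing $\partial_0c*\partial_2c$ by $\partial_1c$, where $\partial_0c:x_1\to x_2$, $\partial_1c:x_0\to x_2$, $\partial_2c:x_0\to x_1$ are $1$-simplices whose supports lie below a common element. $\pi_1^o(K)$ is the group of homotopy classes of loops over $o$, with $[p][q]=[p*q]$. A net of $C^*$-algebras $(\mathcal A,\jmath)_K$ consists of unital $C^*$-algebras $\mathcal A_o$, $o\in K$, and unital injective $*$-homomorphisms $\jmath_{oa}:\mathcal A_a\to\mathcal A_o$, $a\le o$, with $\jmath_{oa}\circ\jmath_{ae}=\jmath_{oe}$ for $e\le a\le o$. It is a $C^*$-net bundle if all $\jmath_{oa}$ are isomorphisms. In that case put $\jmath_b=\jmath_{|b|\partial_0b}^{-1}\circ\jmath_{|b|\partial_1b}$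 and $\jmath_p=\jmath_{b_n}\circ\cdots\circ\jmath_{b_1}$; this depends only on the homotopy class of $p$, and $[p]\mapsto\jmath_p$ is an action $\jmath_*$ of $\pi_1^o(K)$ by automorphisms on the fibre $\mathcal A_*:=\mathcal A_o$, the holonomy dynamical system. The enveloping net bundle $(\overline{\mathcal A},\overline\jmath)_K$ of a net is defined as follows. Let $\overline{\mathcal A}_o$ first be the unital complex $*$-algebra generated by the symbols $(p,A)$, where $p$ is a path from some $a\in K$ to $o$ and $A\in\mathcal A_a$, with $(p,A)^*=(p,A^*)$, subject to the relations that $A\mapsto(p,A)$ is a unital algebra homomorphism for each $p$, that $(p,\jmath_{a'a}(A))=(p*(a'a),A)$ for $a\le a'$, $p:a'\to o$ and $A\in\mathcal A_a$, and that $(p,A)=(q,A)$ if $p\sim q$. Put $\overline\jmath_{o'o}(p,A)=((o'o)*p,A)$ for $o\le o'$. With the $C^*$-seminorm $\|W\|=\sup_\pi\|\pi_o(W)\|$, over all families $\pi=(\pi_o)_{o\in K}$ of $*$-homomorphisms into the fibres of $C^*$-net bundles over $K$ that commute with the inclusion maps, divide by the null elements and complete. The resulting $C^*$-net bundle is again denoted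 by $(\overline{\mathcal A},\overline\jmath)_K$. The canonical embedding is $\epsilon_o(A)=(\iota_o,A)$, with $\iota_o=(oo)$ the trivial loop. The net is injective if $(\overline{\mathcal A},\overline\jmath)_K$ does not vanish (not all its fibres are $\{0\}$) and every $\epsilon_o$ is injective. A Hilbert space representation of the net is a family of (not necessarily unital) $*$-representations $\pi_o:\mathcal A_o\to\mathcal B(\mathcal H)$, $o\in K$, on one Hilbert space $\mathcal H$, with $\pi_o\circ\jmath_{oa}=\pi_a$ for $a\le o$; it is nontrivial if $\pi_o(A)\ne0$ for some $o\in K$ and $A\in\mathcal A_o$. **Proposition.** Let $(\mathcal A,\jmath)_K$ be an injective net of $C^*$-algebras over $K$ and let $o\in K$. Then $(\mathcal A,\jmath)_K$ has nontrivial Hilbert space representations if and only if the ideal $J^{\pi_1^o(K)}_{\overline{\mathcal A}_*}$ is proper, where $\overline{\mathcal A}_*=\overline{\mathcal A}_o$ is the fibre of the holonomy dynamical system $(\overline{\mathcal A}_*,\pi_1^o(K),\alpha)$, $\alpha=\overline\jmath_*$, of the enveloping net bundle, and $J^{\pi_1^o(K)}_{\overline{\mathcal A}_*}$ is the smallest closed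 two-sided $\pi_1^o(K)$-invariant ideal of $\overline{\mathcal A}_*$ that contains all elements $A-\alpha_g(A)$, $A\in\overline{\mathcal A}_*$, $g\in\pi_1^o(K)$. -/

import Mathlib

universe u v w

namespace CStarNets

/-! ### Singular simplices, paths and the fundamental group of a poset -/

/-- A singular 1-simplex `b` of the poset `K` with starting point `∂₁ b = a` and
end point `∂₀ b = o`: it is given by its support `|b|`, with `a ≤ |b|` and `o ≤ |b|`. -/
@[ext]
structure Simplex (K : Type u) [PartialOrder K] (a o : K) where
  supp : K
  le_start : a ≤ supp
  le_end : o ≤ supp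

namespace Simplex

variable {K : Type u} [PartialOrder K]

/-- The opposite 1-simplex. -/
def opp {a o : K} (b : Simplex K a o) : Simplex K o a := ⟨b.supp, b.le_end, b.le_start⟩

/-- The degenerate 1-simplex `σ₀ o`. -/
def degen (o : K) : Simplex K o o := ⟨o, le_rfl, le_rfl⟩

/-- The 1-simplex `(o a)` of the nerve, from `a` to `o`, with support `o`, where `a ≤ o`. -/
def ofLE {a o : K} (h : a ≤ o) : Simplex K a o := ⟨o, h, le_rfl⟩

end Simplex

/-- `SimplexPath K a o` is the type of the paths `b_n * ⋯ * b_1` (`n ≥ 1`) from `a` to `o`;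
`cons b p` is `b * p`. -/
inductive SimplexPath (K : Type u) [PartialOrder K] (a : K) : K → Type u
  | single {o : K} (b : Simplex K a o) : SimplexPath K a o
  | cons {e o : K} (b : Simplex K e o) (p : SimplexPath K a e) : SimplexPath K a o

namespace SimplexPath

variable {K : Type u} [PartialOrder K]

/-- The composition `q * p` (first `p`, then `q`). -/
def comp {a e : K} : {o : K} → SimplexPath K e o → SimplexPath K a e → SimplexPath K a o
  | _, single b, p => cons b p
  | _, cons b q, p => cons b (comp q p)

/-- The opposite path. -/
def opp {a : K} : {o : K} → SimplexPath K a o → SimplexPath K o a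
  | _, single b => single b.opp
  | _, cons b p => (opp p).comp (single b.opp)

/-- The trivial loop `ι_o`, that is, the degenerate 1-simplex `σ₀ o`. -/
def triv (o : K) : SimplexPath K o o := single (Simplex.degen o)

theorem comp_assoc {a e f o : K} (r : SimplexPath K f o) (q : SimplexPath K e f)
    (p : SimplexPath K a e) : (r.comp q).comp p = r.comp (q.comp p) := by
  induction r with
  | single b => rfl
  | cons b r ih => simp only [comp, ih]

/-- Homotopy equivalence of paths: the smallest equivalence relation, compatible with the
composition of paths, that identifies `∂₀c * ∂₂c` with `∂₁c` for every singular 2-simplex `c`.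
A 2-simplex `c` with vertices `x₀`, `x₁`, `x₂` consists of the three faces
`∂₀c : x₁ → x₂`, `∂₁c : x₀ → x₂`, `∂₂c : x₀ → x₁` and a support `s` that contains the supports
of the faces. -/
inductive Homotopic : {a o : K} → SimplexPath K a o → SimplexPath K a o → Prop
  | triangle {x₀ x₁ x₂ : K} (b₀ : Simplex K x₁ x₂) (b₁ : Simplex K x₀ x₂) (b₂ : Simplex K x₀ x₁)
      (s : K) (h₀ : b₀.supp ≤ s) (h₁ : b₁.supp ≤ s) (h₂ : b₂.supp ≤ s) :
      Homotopic (cons b₀ (single b₂)) (single b₁)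
  | refl {a o : K} (p : SimplexPath K a o) : Homotopic p p
  | symm {a o : K} {p q : SimplexPath K a o} : Homotopic p q → Homotopic q p
  | trans {a o : K} {p q r : SimplexPath K a o} :
      Homotopic p q → Homotopic q r → Homotopic p r
  | comp {a e o : K} {q q' : SimplexPath K e o} {p p' : SimplexPath K a e} :
      Homotopic q q' → Homotopic p p' → Homotopic (q.comp p) (q'.comp p')

theorem triv_comp {a o : K} (p : SimplexPath K a o) : Homotopic ((triv o).comp p) p := by
  cases p with
  | single b => exact .triangle _ _ _ b.supp b.le_end le_rfl le_rfl
  | cons b q =>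
    exact Homotopic.comp (q := cons (Simplex.degen o) (single b)) (q' := single b)
      (.triangle _ _ _ b.supp b.le_end le_rfl le_rfl) (.refl q)

theorem comp_triv {a o : K} (p : SimplexPath K a o) : Homotopic (p.comp (triv a)) p := by
  induction p with
  | single b => exact .triangle _ _ _ b.supp le_rfl le_rfl b.le_start
  | cons b q ih => exact Homotopic.comp (q := single b) (q' := single b) (.refl _) ih

theorem opp_comp {a o : K} (p : SimplexPath K a o) : Homotopic (p.opp.comp p) (triv a) := by
  induction p with
  | single b => exact .triangle _ _ _ b.supp le_rfl b.le_start le_rfl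
  | @cons e o b q ih =>
    have h1 : Homotopic ((single b.opp).comp (single b)) (triv e) :=
      .triangle _ _ _ b.supp le_rfl b.le_start le_rfl
    have h2 : (opp (cons b q)).comp (cons b q) =
        (opp q).comp (((single b.opp).comp (single b)).comp q) := by
      simp only [opp, comp_assoc]; rfl
    rw [h2]
    exact (Homotopic.comp (.refl _) ((Homotopic.comp h1 (.refl q)).trans (triv_comp q))).trans ih

theorem comp_opp {a o : K} (p : SimplexPath K a o) : Homotopic (p.comp p.opp) (triv o) := by
  induction p with
  | single b => exact .triangle _ _ _ b.supp le_rfl b.le_end le_rfl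
  | @cons e o b q ih =>
    have h1 : Homotopic ((single b).comp (single b.opp)) (triv o) :=
      .triangle _ _ _ b.supp le_rfl b.le_end le_rfl
    have h2 : (cons b q).comp (opp (cons b q)) =
        (single b).comp ((q.comp q.opp).comp (single b.opp)) := by
      simp only [opp, comp_assoc]; rfl
    rw [h2]
    exact (Homotopic.comp (.refl _) ((Homotopic.comp ih (.refl _)).trans (triv_comp _))).trans h1

theorem Homotopic.opp {a o : K} {p q : SimplexPath K a o} (h : Homotopic p q) :
    Homotopic p.opp q.opp := by
  have h1 : Homotopic (p.opp.comp (q.comp q.opp)) p.opp :=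
    (Homotopic.comp (.refl _) (comp_opp q)).trans (comp_triv _)
  have h2 : Homotopic ((p.opp.comp q).comp q.opp) q.opp :=
    (Homotopic.comp ((Homotopic.comp (.refl _) h.symm).trans (opp_comp p)) (.refl _)).trans
      (triv_comp _)
  rw [comp_assoc] at h2
  exact h1.symm.trans h2

/-- Homotopy equivalence of loops over `o`. -/
def loopSetoid (o : K) : Setoid (SimplexPath K o o) where
  r := Homotopic
  iseqv := ⟨.refl, .symm, .trans⟩

end SimplexPath

/-- A poset is pathwise connected if any two of its elements are joined by a path. -/
def IsPathwiseConnected (K : Type u) [PartialOrder K] : Prop :=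
  ∀ a o : K, Nonempty (SimplexPath K a o)

/-- The first homotopy group `π₁ᵒ(K)`: homotopy classes of loops over `o`. -/
def FundGroup (K : Type u) [PartialOrder K] (o : K) : Type u :=
  Quotient (SimplexPath.loopSetoid (K := K) o)

namespace FundGroup

open SimplexPath

variable {K : Type u} [PartialOrder K] {o : K}

/-- The homotopy class `[p]` of a loop. -/
def mk (p : SimplexPath K o o) : FundGroup K o := Quotient.mk (loopSetoid o) p

/-- The product is `[p] · [q] = [p * q]`. -/
instance : Group (FundGroup K o) where
  mul := Quotient.map₂ (fun p q => p.comp q) (fun _ _ hp _ _ hq => Homotopic.comp hp hq)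
  one := mk (triv o)
  inv := Quotient.map SimplexPath.opp (fun _ _ h => Homotopic.opp h)
  mul_assoc := by
    rintro ⟨p⟩ ⟨q⟩ ⟨r⟩
    exact congrArg mk (comp_assoc p q r)
  one_mul := by
    rintro ⟨p⟩
    exact Quotient.sound (s := loopSetoid o) (triv_comp p)
  mul_one := by
    rintro ⟨p⟩
    exact Quotient.sound (s := loopSetoid o) (comp_triv p)
  inv_mul_cancel := by
    rintro ⟨p⟩
    exact Quotient.sound (s := loopSetoid o) (opp_comp p)

theorem mk_mul (p q : SimplexPath K o o) : mk p * mk q = mk (p.comp q) := rfl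

theorem mk_eq {p q : SimplexPath K o o} (h : p.Homotopic q) : mk p = mk q :=
  Quotient.sound (s := loopSetoid o) h

end FundGroup

/-! ### Nets of C*-algebras, net bundles and holonomy -/

/-- A net of (unital) C*-algebras over the poset `K`. -/
structure CStarNet (K : Type u) [PartialOrder K] where
  /-- the fibre over `o` -/
  fibre : K → Type v
  [cstar : ∀ o, CStarAlgebra (fibre o)]
  /-- the inclusion maps -/
  incl : ∀ {a o : K}, a ≤ o → (fibre a →⋆ₐ[ℂ] fibre o)
  incl_injective : ∀ {a o : K} (h : a ≤ o), Function.Injective (incl h)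
  incl_incl : ∀ {e a o : K} (h₁ : e ≤ a) (h₂ : a ≤ o) (A : fibre e),
    incl h₂ (incl h₁ A) = incl (h₁.trans h₂) A

attribute [instance] CStarNet.cstar

namespace CStarNet

variable {K : Type u} [PartialOrder K]

/-- A net of C*-algebras is a C*-net bundle if all its inclusion maps are isomorphisms. -/
def IsNetBundle (N : CStarNet.{u, v} K) : Prop :=
  ∀ {a o : K} (h : a ≤ o), Function.Bijective (N.incl h)

/-- A net vanishes if it is isomorphic to the null net bundle, that is, if all its fibres
are `{0}`. -/
def Vanishes (N : CStarNet.{u, v} K) : Prop := ∀ o, Subsingleton (N.fibre o)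

section Holonomy

variable (N : CStarNet.{u, v} K) (hN : N.IsNetBundle)

/-- The inclusion maps of a net bundle, as isomorphisms. -/
noncomputable def inclEquiv {a o : K} (h : a ≤ o) : N.fibre a ≃⋆ₐ[ℂ] N.fibre o :=
  StarAlgEquiv.ofBijective (N.incl h) (hN h)

/-- `ȷ_b = ȷ_{|b| ∂₀b}⁻¹ ∘ ȷ_{|b| ∂₁b}`. -/
noncomputable def holSimplex {a o : K} (b : Simplex K a o) : N.fibre a ≃⋆ₐ[ℂ] N.fibre o :=
  (N.inclEquiv hN b.le_start).trans (N.inclEquiv hN b.le_end).symm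

/-- `ȷ_p = ȷ_{b_n} ∘ ⋯ ∘ ȷ_{b_1}` for a path `p = b_n * ⋯ * b_1`. -/
noncomputable def holPath {a : K} : {o : K} → SimplexPath K a o → (N.fibre a ≃⋆ₐ[ℂ] N.fibre o)
  | _, .single b => N.holSimplex hN b
  | _, .cons b p => (holPath p).trans (N.holSimplex hN b)

theorem incl_holSimplex {a o : K} (b : Simplex K a o) (A : N.fibre a) :
    N.incl b.le_end (N.holSimplex hN b A) = N.incl b.le_start A :=
  (N.inclEquiv hN b.le_end).apply_symm_apply (N.incl b.le_start A)

theorem incl_holSimplex' {a o s : K} (b : Simplex K a o) (hs : b.supp ≤ s) (A : N.fibre a) :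
    N.incl (b.le_end.trans hs) (N.holSimplex hN b A) = N.incl (b.le_start.trans hs) A := by
  rw [← N.incl_incl b.le_end hs, incl_holSimplex, N.incl_incl]

theorem holPath_comp {a e o : K} (q : SimplexPath K e o) (p : SimplexPath K a e)
    (A : N.fibre a) : N.holPath hN (q.comp p) A = N.holPath hN q (N.holPath hN p A) := by
  induction q with
  | single b => rfl
  | cons b q ih => exact congrArg (N.holSimplex hN b) ih

theorem holPath_homotopic {a o : K} {p q : SimplexPath K a o} (h : p.Homotopic q)
    (A : N.fibre a) : N.holPath hN p A = N.holPath hN q A := by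
  induction h with
  | triangle b₀ b₁ b₂ s h₀ h₁ h₂ =>
    apply N.incl_injective (b₀.le_end.trans h₀)
    change N.incl _ (N.holSimplex hN b₀ (N.holSimplex hN b₂ A)) =
      N.incl (b₁.le_end.trans h₁) (N.holSimplex hN b₁ A)
    rw [incl_holSimplex' N hN b₀ h₀, incl_holSimplex' N hN b₁ h₁]
    exact incl_holSimplex' N hN b₂ h₂ A
  | refl p => rfl
  | symm _ ih => exact (ih A).symm
  | trans _ _ ih₁ ih₂ => exact (ih₁ A).trans (ih₂ A)
  | comp _ _ ih₁ ih₂ => rw [holPath_comp, holPath_comp, ih₂, ih₁]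

theorem holPath_triv {o : K} (A : N.fibre o) : N.holPath hN (SimplexPath.triv o) A = A :=
  (N.inclEquiv hN (le_refl o)).symm_apply_apply A

/-- The holonomy dynamical system of a C*-net bundle: the action `[p] ↦ ȷ_p` of `π₁ᵒ(K)` on the
fibre over `o`. -/
noncomputable def holonomy (o : K) : FundGroup K o →* (N.fibre o ≃⋆ₐ[ℂ] N.fibre o) where
  toFun := Quotient.lift (s := SimplexPath.loopSetoid o) (fun p => N.holPath hN p)
    (fun _ _ h => StarAlgEquiv.ext fun A => N.holPath_homotopic hN h A)
  map_one' := StarAlgEquiv.ext fun A => N.holPath_triv hN A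
  map_mul' := by
    rintro ⟨p⟩ ⟨q⟩
    exact StarAlgEquiv.ext fun A => N.holPath_comp hN p q A

end Holonomy

end CStarNet

/-- For an action `α` of a group `G` by automorphisms of the C*-algebra `A`, the ideal `J^G_A`:
the smallest (closed, two-sided) ideal of `A` that is `G`-invariant and contains the elements
`a - α_g(a)`. -/
def coinvariantIdeal {A : Type v} {G : Type u} [CStarAlgebra A] [Group G]
    (α : G →* (A ≃⋆ₐ[ℂ] A)) : TwoSidedIdeal A :=
  sInf {I | IsClosed {x : A | x ∈ I} ∧ (∀ g : G, ∀ x ∈ I, α g x ∈ I) ∧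
    ∀ (g : G) (a : A), a - α g a ∈ I}

/-! ### Free *-algebras -/

/-- The free unital complex algebra on `X`. -/
def FreeStarAlg (X : Type u) : Type u := FreeAlgebra ℂ X

namespace FreeStarAlg

noncomputable section

instance (X : Type u) : Ring (FreeStarAlg X) := inferInstanceAs (Ring (FreeAlgebra ℂ X))

instance (X : Type u) : Algebra ℂ (FreeStarAlg X) :=
  inferInstanceAs (Algebra ℂ (FreeAlgebra ℂ X))

/-- The generators. -/
def gen {X : Type u} (x : X) : FreeStarAlg X := FreeAlgebra.ι ℂ x

theorem induction {X : Type u} {C : FreeStarAlg X → Prop}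
    (h₁ : ∀ c : ℂ, C (algebraMap ℂ (FreeStarAlg X) c)) (h₂ : ∀ x, C (gen x))
    (h₃ : ∀ a b, C a → C b → C (a * b)) (h₄ : ∀ a b, C a → C b → C (a + b))
    (a : FreeStarAlg X) : C a :=
  FreeAlgebra.induction (motive := C) ℂ X h₁ h₂ h₃ h₄ a

/-- Algebra homomorphisms out of the free algebra. -/
def lift {X : Type u} {B : Type v} [Ring B] [Algebra ℂ B] (f : X → B) : FreeStarAlg X →ₐ[ℂ] B :=
  FreeAlgebra.lift ℂ f

@[simp]
theorem lift_gen {X : Type u} {B : Type v} [Ring B] [Algebra ℂ B] (f : X → B) (x : X) :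
    lift f (gen x) = f x := FreeAlgebra.lift_ι_apply f x

variable {X : Type u} [InvolutiveStar X]

/-- The adjoint of the free algebra on a set `X` with an involution, as a ring homomorphism to
the opposite ring: on generators it is the involution of `X`, and it is extended by
anti-multiplicativity and anti-linearity. -/
def starHom : FreeStarAlg X →+* (FreeStarAlg X)ᵐᵒᵖ :=
  letI : Algebra ℂ (FreeStarAlg X)ᵐᵒᵖ :=
    ((algebraMap ℂ (FreeStarAlg X)ᵐᵒᵖ).comp (starRingEnd ℂ)).toAlgebra'
      (fun c x => Algebra.commutes (starRingEnd ℂ c) x)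
  (lift (fun x : X => MulOpposite.op (gen (star x)))).toRingHom

theorem starHom_algebraMap (c : ℂ) :
    starHom (algebraMap ℂ (FreeStarAlg X) c) =
      MulOpposite.op (algebraMap ℂ (FreeStarAlg X) (starRingEnd ℂ c)) :=
  letI : Algebra ℂ (FreeStarAlg X)ᵐᵒᵖ :=
    ((algebraMap ℂ (FreeStarAlg X)ᵐᵒᵖ).comp (starRingEnd ℂ)).toAlgebra'
      (fun c x => Algebra.commutes (starRingEnd ℂ c) x)
  (lift (fun x : X => MulOpposite.op (gen (star x)))).commutes c

theorem starHom_gen (x : X) : starHom (gen x) = MulOpposite.op (gen (star x)) :=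
  letI : Algebra ℂ (FreeStarAlg X)ᵐᵒᵖ :=
    ((algebraMap ℂ (FreeStarAlg X)ᵐᵒᵖ).comp (starRingEnd ℂ)).toAlgebra'
      (fun c x => Algebra.commutes (starRingEnd ℂ c) x)
  lift_gen (fun x : X => MulOpposite.op (gen (star x))) x

/-- The *-algebra structure of the free algebra on a set with an involution. -/
instance : StarRing (FreeStarAlg X) where
  star a := (starHom a).unop
  star_involutive a := by
    change (starHom (starHom a).unop).unop = a
    induction a using FreeStarAlg.induction with
    | h₁ c => simp [starHom_algebraMap]
    | h₂ x => simp [starHom_gen]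
    | h₃ a b ha hb => simp [ha, hb]
    | h₄ a b ha hb => simp [ha, hb]
  star_mul a b := by simp
  star_add a b := by simp

theorem star_gen (x : X) : star (gen x) = gen (star x) :=
  congrArg MulOpposite.unop (starHom_gen x)

theorem star_algebraMap (c : ℂ) : star (algebraMap ℂ (FreeStarAlg X) c) =
    algebraMap ℂ (FreeStarAlg X) (star c) :=
  congrArg MulOpposite.unop (starHom_algebraMap c)

end

end FreeStarAlg

/-! ### The C*-algebra associated with a *-algebra and a C*-seminorm -/

/-- A C*-seminorm on a complex *-algebra. -/
structure CStarSeminorm (A : Type v) [Ring A] [StarRing A] [Algebra ℂ A] extends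
    RingSeminorm A where
  smul_le' : ∀ (c : ℂ) (a : A), toFun (c • a) ≤ ‖c‖ * toFun a
  star_le' : ∀ a : A, toFun (star a) ≤ toFun a
  cstar' : ∀ a : A, toFun a * toFun a ≤ toFun (star a * a)

namespace CStarSeminorm

noncomputable section

variable {A : Type v} [Ring A] [StarRing A] [Algebra ℂ A]

/-- The *-algebra `A`, equipped with the seminorm `p`. -/
def Carrier (_ : CStarSeminorm A) : Type v := A

variable (p : CStarSeminorm A)

instance : SeminormedRing p.Carrier := RingSeminorm.toSeminormedRing (R := A) p.toRingSeminorm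

instance : Algebra ℂ p.Carrier := inferInstanceAs (Algebra ℂ A)

instance : StarRing p.Carrier := inferInstanceAs (StarRing A)

instance [StarModule ℂ A] : StarModule ℂ p.Carrier := inferInstanceAs (StarModule ℂ A)

instance : NormedAlgebra ℂ p.Carrier where
  norm_smul_le := p.smul_le'

theorem norm_star_carrier (a : p.Carrier) : ‖star a‖ = ‖a‖ := by
  refine le_antisymm (p.star_le' a) ?_
  have h := p.star_le' (star (show A from a))
  rwa [star_star] at h

/-- The completion of the quotient of `A` by the ideal of null elements. (The completion of a
seminormed space in Mathlib contains the passage to this quotient.) -/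
def Compl : Type v := UniformSpace.Completion p.Carrier

instance : NormedRing p.Compl := inferInstanceAs (NormedRing (UniformSpace.Completion p.Carrier))

instance : CompleteSpace p.Compl :=
  inferInstanceAs (CompleteSpace (UniformSpace.Completion p.Carrier))

instance : Algebra ℂ p.Compl := inferInstanceAs (Algebra ℂ (UniformSpace.Completion p.Carrier))

/-- The canonical map from `A` to the completion. -/
def toCompl (a : A) : p.Compl := ((show p.Carrier from a : p.Carrier) :
  UniformSpace.Completion p.Carrier)

theorem norm_toCompl (a : A) : ‖p.toCompl a‖ = p.toFun a :=
  UniformSpace.Completion.norm_coe (show p.Carrier from a)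

theorem toCompl_add (a b : A) : p.toCompl (a + b) = p.toCompl a + p.toCompl b :=
  UniformSpace.Completion.coe_add (show p.Carrier from a) (show p.Carrier from b)

theorem toCompl_mul (a b : A) : p.toCompl (a * b) = p.toCompl a * p.toCompl b :=
  UniformSpace.Completion.coe_mul (show p.Carrier from a) (show p.Carrier from b)

theorem toCompl_algebraMap (c : ℂ) :
    p.toCompl (algebraMap ℂ A c) = algebraMap ℂ p.Compl c := rfl

theorem toCompl_smul (c : ℂ) (a : A) : p.toCompl (c • a) = c • p.toCompl a := by
  rw [Algebra.smul_def, Algebra.smul_def, toCompl_mul, toCompl_algebraMap]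

theorem toCompl_one : p.toCompl 1 = 1 := rfl

theorem toCompl_zero : p.toCompl 0 = 0 := rfl

theorem denseRange_toCompl : DenseRange p.toCompl :=
  UniformSpace.Completion.denseRange_coe (α := p.Carrier)

theorem compl_induction {C : p.Compl → Prop} (hC : IsClosed {x | C x})
    (h : ∀ a : A, C (p.toCompl a)) (x : p.Compl) : C x :=
  p.denseRange_toCompl.induction_on x hC h

instance : NormedAlgebra ℂ p.Compl where
  norm_smul_le c x := by
    induction x using p.compl_induction with
    | hC =>
      simp only [Algebra.smul_def]
      exact isClosed_le (by fun_prop) (by fun_prop)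
    | h a =>
      rw [← toCompl_smul, norm_toCompl, norm_toCompl]
      exact p.smul_le' c a

theorem lipschitz_star_carrier : LipschitzWith 1 (fun a : p.Carrier => star a) :=
  LipschitzWith.of_dist_le_mul fun a b => by
    rw [dist_eq_norm, dist_eq_norm, ← star_sub, norm_star_carrier]; simp

instance : Star p.Compl :=
  ⟨UniformSpace.Completion.map (fun a : p.Carrier => star a)⟩

theorem continuous_star_compl : Continuous (fun x : p.Compl => star x) :=
  UniformSpace.Completion.continuous_map (f := fun a : p.Carrier => star a)

theorem star_toCompl (a : A) : star (p.toCompl a) = p.toCompl (star a) :=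
  UniformSpace.Completion.map_coe p.lipschitz_star_carrier.uniformContinuous a

instance : StarRing p.Compl where
  star_involutive x := by
    induction x using p.compl_induction with
    | hC => exact isClosed_eq (p.continuous_star_compl.comp p.continuous_star_compl) continuous_id
    | h a => rw [star_toCompl, star_toCompl, star_star]
  star_mul x y := by
    have hc := p.continuous_star_compl
    induction x using p.compl_induction with
    | hC => exact isClosed_eq (hc.comp (continuous_mul_const y)) (hc.const_mul _)
    | h a =>
      induction y using p.compl_induction with
      | hC => exact isClosed_eq (hc.comp (continuous_const_mul _)) (hc.mul_const _)
      | h b => simp only [← toCompl_mul, star_toCompl, star_mul]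
  star_add x y := by
    have hc := p.continuous_star_compl
    induction x using p.compl_induction with
    | hC => exact isClosed_eq (hc.comp (by fun_prop)) (hc.add continuous_const)
    | h a =>
      induction y using p.compl_induction with
      | hC => exact isClosed_eq (hc.comp (by fun_prop)) (continuous_const.add hc)
      | h b => simp only [← toCompl_add, star_toCompl, star_add]

instance : CStarRing p.Compl where
  norm_mul_self_le x := by
    have hc := p.continuous_star_compl
    induction x using p.compl_induction with
    | hC => exact isClosed_le (by fun_prop) (continuous_norm.comp (hc.mul continuous_id))
    | h a =>
      rw [star_toCompl, ← toCompl_mul, norm_toCompl, norm_toCompl]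
      exact p.cstar' a

instance [StarModule ℂ A] : StarModule ℂ p.Compl where
  star_smul c x := by
    have hc := p.continuous_star_compl
    induction x using p.compl_induction with
    | hC => exact isClosed_eq (hc.comp (continuous_const_smul c)) ((continuous_const_smul (star c)).comp hc)
    | h a => rw [← toCompl_smul, star_toCompl, star_toCompl, star_smul, toCompl_smul]

instance [StarModule ℂ A] : CStarAlgebra p.Compl where

variable {p} {B : Type v} [Ring B] [StarRing B] [Algebra ℂ B] {q : CStarSeminorm B}

/-- An isometric *-homomorphism, as a ring homomorphism of seminormed rings. -/
def carrierHom (f : A →⋆ₐ[ℂ] B) : p.Carrier →+* q.Carrier := f.toAlgHom.toRingHom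

theorem isometry_carrierHom (f : A →⋆ₐ[ℂ] B) (hf : ∀ a, q.toFun (f a) = p.toFun a) :
    Isometry (carrierHom f : p.Carrier →+* q.Carrier) :=
  AddMonoidHomClass.isometry_of_norm (carrierHom f : p.Carrier →+* q.Carrier) hf

/-- The extension to the completions, as a ring homomorphism. -/
def complHom (f : A →⋆ₐ[ℂ] B) (hf : ∀ a, q.toFun (f a) = p.toFun a) : p.Compl →+* q.Compl :=
  UniformSpace.Completion.mapRingHom (carrierHom f) (isometry_carrierHom f hf).continuous

theorem continuous_complHom (f : A →⋆ₐ[ℂ] B) (hf : ∀ a, q.toFun (f a) = p.toFun a) :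
    Continuous (complHom f hf) :=
  UniformSpace.Completion.continuous_map (f := (carrierHom f : p.Carrier →+* q.Carrier))

theorem complHom_toCompl (f : A →⋆ₐ[ℂ] B) (hf : ∀ a, q.toFun (f a) = p.toFun a) (a : A) :
    complHom f hf (p.toCompl a) = q.toCompl (f a) :=
  UniformSpace.Completion.map_coe (isometry_carrierHom f hf).uniformContinuous a

/-- An isometric *-homomorphism extends to the completions. -/
def mapCompl (f : A →⋆ₐ[ℂ] B) (hf : ∀ a, q.toFun (f a) = p.toFun a) :
    p.Compl →⋆ₐ[ℂ] q.Compl where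
  __ := complHom f hf
  commutes' c := by
    refine (complHom_toCompl f hf (algebraMap ℂ A c)).trans ?_
    rw [AlgHomClass.commutes, toCompl_algebraMap]
  map_star' x := by
    change complHom f hf (star x) = star (complHom f hf x)
    induction x using p.compl_induction with
    | hC =>
      exact isClosed_eq ((continuous_complHom f hf).comp p.continuous_star_compl)
        (q.continuous_star_compl.comp (continuous_complHom f hf))
    | h a => rw [star_toCompl, complHom_toCompl, complHom_toCompl, map_star, star_toCompl]

theorem mapCompl_toCompl (f : A →⋆ₐ[ℂ] B) (hf : ∀ a, q.toFun (f a) = p.toFun a) (a : A) :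
    mapCompl f hf (p.toCompl a) = q.toCompl (f a) := complHom_toCompl f hf a

theorem norm_mapCompl (f : A →⋆ₐ[ℂ] B) (hf : ∀ a, q.toFun (f a) = p.toFun a) (x : p.Compl) :
    ‖mapCompl f hf x‖ = ‖x‖ := by
  have hcont : Continuous (mapCompl f hf) := continuous_complHom f hf
  induction x using p.compl_induction with
  | hC => exact isClosed_eq (continuous_norm.comp hcont) continuous_norm
  | h a => rw [mapCompl_toCompl, norm_toCompl, norm_toCompl, hf]

theorem mapCompl_injective (f : A →⋆ₐ[ℂ] B) (hf : ∀ a, q.toFun (f a) = p.toFun a) :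
    Function.Injective (mapCompl f hf) :=
  (AddMonoidHomClass.isometry_of_norm _ (norm_mapCompl f hf)).injective

theorem mapCompl_surjective (f : A →⋆ₐ[ℂ] B) (hf : ∀ a, q.toFun (f a) = p.toFun a)
    (hs : Function.Surjective f) : Function.Surjective (mapCompl f hf) := by
  have hi : Isometry (mapCompl f hf) := AddMonoidHomClass.isometry_of_norm _ (norm_mapCompl f hf)
  have hcl : IsClosed (Set.range (mapCompl f hf)) := hi.isClosedEmbedding.isClosed_range
  intro y
  induction y using q.compl_induction with
  | hC => exact hcl
  | h b =>
    obtain ⟨a, rfl⟩ := hs b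
    exact ⟨p.toCompl a, mapCompl_toCompl f hf a⟩

end

end CStarSeminorm

/-! ### The enveloping net bundle -/

namespace CStarNet

noncomputable section

variable {K : Type u} [PartialOrder K] (N : CStarNet.{u, v} K)

/-- The symbols `(p, A)`, where `p` is a path that ends at `o` and `A` is an element of the fibre
over its starting point. -/
structure EnvGen (o : K) : Type (max u v) where
  src : K
  path : SimplexPath K src o
  elt : N.fibre src

instance (o : K) : InvolutiveStar (N.EnvGen o) where
  star x := ⟨x.src, x.path, star x.elt⟩
  star_involutive x := by
    change EnvGen.mk x.src x.path (star (star x.elt)) = x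
    rw [star_star]

variable {N} in
/-- The generator `(p, A)` of the free *-algebra. -/
def envSymb {a o : K} (p : SimplexPath K a o) (A : N.fibre a) : FreeStarAlg (N.EnvGen o) :=
  FreeStarAlg.gen ⟨a, p, A⟩

/-- The relations imposed on the symbols `(p, A)`. -/
inductive EnvRel (o : K) : FreeStarAlg (N.EnvGen o) → FreeStarAlg (N.EnvGen o) → Prop
  | mul {a : K} (p : SimplexPath K a o) (A B : N.fibre a) :
      EnvRel o (envSymb p A * envSymb p B) (envSymb p (A * B))
  | add {a : K} (p : SimplexPath K a o) (A B : N.fibre a) :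
      EnvRel o (envSymb p (A + B)) (envSymb p A + envSymb p B)
  | smul {a : K} (p : SimplexPath K a o) (c : ℂ) (A : N.fibre a) :
      EnvRel o (envSymb p (c • A)) (c • envSymb p A)
  | one {a : K} (p : SimplexPath K a o) : EnvRel o (envSymb p (1 : N.fibre a)) 1
  | zero {a : K} (p : SimplexPath K a o) : EnvRel o (envSymb p (0 : N.fibre a)) 0
  | isotony {a a' : K} (h : a ≤ a') (p : SimplexPath K a' o) (A : N.fibre a) :
      EnvRel o (envSymb p (N.incl h A))
        (envSymb (p.comp (.single (Simplex.ofLE h))) A)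
  | homotopy {a : K} {p q : SimplexPath K a o} (h : p.Homotopic q) (A : N.fibre a) :
      EnvRel o (envSymb p A) (envSymb q A)

/-- The *-algebra generated by the symbols `(p, A)` and the relations above. -/
def EnvAlg (o : K) : Type (max u v) := RingQuot (N.EnvRel o)

namespace EnvAlg

variable {o : K}

instance : Ring (N.EnvAlg o) := inferInstanceAs (Ring (RingQuot (N.EnvRel o)))

instance : Algebra ℂ (N.EnvAlg o) := inferInstanceAs (Algebra ℂ (RingQuot (N.EnvRel o)))

/-- The quotient map from the free *-algebra. -/
def quot : FreeStarAlg (N.EnvGen o) →ₐ[ℂ] N.EnvAlg o := RingQuot.mkAlgHom ℂ (N.EnvRel o)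

variable {N} in
theorem quot_rel {x y : FreeStarAlg (N.EnvGen o)} (h : N.EnvRel o x y) :
    quot N x = quot N y := RingQuot.mkAlgHom_rel ℂ h

theorem quot_surjective : Function.Surjective (quot N (o := o)) :=
  RingQuot.mkAlgHom_surjective ℂ (N.EnvRel o)

variable {N} in
/-- The element `(p, A)`. -/
def symb {a o : K} (p : SimplexPath K a o) (A : N.fibre a) : N.EnvAlg o := quot N (envSymb p A)

theorem induction {C : N.EnvAlg o → Prop}
    (h₁ : ∀ c : ℂ, C (algebraMap ℂ (N.EnvAlg o) c))
    (h₂ : ∀ {a : K} (p : SimplexPath K a o) (A : N.fibre a), C (symb p A))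
    (h₃ : ∀ a b, C a → C b → C (a * b)) (h₄ : ∀ a b, C a → C b → C (a + b))
    (W : N.EnvAlg o) : C W := by
  obtain ⟨W, rfl⟩ := quot_surjective N W
  induction W using FreeStarAlg.induction with
  | h₁ c => rw [AlgHom.commutes]; exact h₁ c
  | h₂ x => exact h₂ x.path x.elt
  | h₃ a b ha hb => rw [map_mul]; exact h₃ _ _ ha hb
  | h₄ a b ha hb => rw [map_add]; exact h₄ _ _ ha hb

variable {N} in
/-- Algebra homomorphisms out of the *-algebra. -/
def lift {B : Type w} [Ring B] [Algebra ℂ B] (f : FreeStarAlg (N.EnvGen o) →ₐ[ℂ] B)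
    (hf : ∀ ⦃x y⦄, N.EnvRel o x y → f x = f y) : N.EnvAlg o →ₐ[ℂ] B :=
  RingQuot.liftAlgHom ℂ ⟨f, hf⟩

variable {N} in
theorem lift_quot {B : Type w} [Ring B] [Algebra ℂ B] (f : FreeStarAlg (N.EnvGen o) →ₐ[ℂ] B)
    (hf : ∀ ⦃x y⦄, N.EnvRel o x y → f x = f y) (x : FreeStarAlg (N.EnvGen o)) :
    lift f hf (quot N x) = f x := RingQuot.liftAlgHom_mkAlgHom_apply ℂ f hf x

theorem star_envSymb {a : K} (p : SimplexPath K a o) (A : N.fibre a) :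
    star (envSymb p A) = envSymb p (star A) := FreeStarAlg.star_gen _

theorem quot_star_rel {x y : FreeStarAlg (N.EnvGen o)} (h : N.EnvRel o x y) :
    quot N (star x) = quot N (star y) := by
  cases h with
  | mul p A B => rw [star_mul]; simp only [star_envSymb, star_mul]; exact quot_rel (.mul p _ _)
  | add p A B => simp only [star_add, star_envSymb]; exact quot_rel (.add p _ _)
  | smul p c A =>
    simp only [Algebra.smul_def (A := FreeStarAlg _), star_mul, star_envSymb,
      FreeStarAlg.star_algebraMap, star_smul]
    rw [← Algebra.commutes, ← Algebra.smul_def]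
    exact quot_rel (.smul p _ _)
  | one p => rw [star_envSymb, star_one, star_one]; exact quot_rel (.one p)
  | zero p => rw [star_envSymb, star_zero, star_zero]; exact quot_rel (.zero p)
  | isotony h p A =>
    rw [star_envSymb, star_envSymb, ← map_star]; exact quot_rel (.isotony h p _)
  | homotopy h A => rw [star_envSymb, star_envSymb]; exact quot_rel (.homotopy h _)

/-- The adjoint on the quotient, as a ring homomorphism to the opposite ring. -/
def starHom : N.EnvAlg o →+* (N.EnvAlg o)ᵐᵒᵖ :=
  RingQuot.lift
    ⟨((quot N).toRingHom.op).comp (FreeStarAlg.starHom),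
      fun _ _ h => congrArg MulOpposite.op (quot_star_rel N h)⟩

theorem starHom_quot (x : FreeStarAlg (N.EnvGen o)) :
    starHom N (quot N x) = MulOpposite.op (quot N (star x)) := by
  have h : quot N x = RingQuot.mkRingHom (N.EnvRel o) x := by
    rw [← RingQuot.mkAlgHom_coe ℂ]; rfl
  rw [h]
  exact RingQuot.lift_mkRingHom_apply _ _ x

instance : StarRing (N.EnvAlg o) where
  star W := (starHom N W).unop
  star_involutive W := by
    obtain ⟨x, rfl⟩ := quot_surjective N W
    change (starHom N (starHom N (quot N x)).unop).unop = _
    rw [starHom_quot, MulOpposite.unop_op, starHom_quot, MulOpposite.unop_op, star_star]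
  star_mul a b := by simp
  star_add a b := by simp

theorem star_quot (x : FreeStarAlg (N.EnvGen o)) : star (quot N x) = quot N (star x) :=
  congrArg MulOpposite.unop (starHom_quot N x)

theorem star_symb {a : K} (p : SimplexPath K a o) (A : N.fibre a) :
    star (symb p A) = symb p (star A) := by
  rw [symb, star_quot, star_envSymb]; rfl

theorem star_algebraMap (c : ℂ) :
    star (algebraMap ℂ (N.EnvAlg o) c) = algebraMap ℂ (N.EnvAlg o) (star c) := by
  rw [← AlgHom.commutes (quot N), star_quot, FreeStarAlg.star_algebraMap, AlgHom.commutes]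

instance : StarModule ℂ (N.EnvAlg o) where
  star_smul c W := by
    rw [Algebra.smul_def, star_mul, star_algebraMap, ← Algebra.commutes, ← Algebra.smul_def]

/-- The map `(p, A) ↦ (r * p, A)` for a path `r : o → o'`, on the algebra level. -/
def pushAlgHom {o' : K} (r : SimplexPath K o o') : N.EnvAlg o →ₐ[ℂ] N.EnvAlg o' :=
  lift (FreeStarAlg.lift fun x => symb (r.comp x.path) x.elt) (by
    intro x y h
    have key : ∀ {a : K} (p : SimplexPath K a o) (A : N.fibre a),
        FreeStarAlg.lift (fun x : N.EnvGen o => symb (r.comp x.path) x.elt) (envSymb p A) =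
          quot N (envSymb (r.comp p) A) := fun p A => FreeStarAlg.lift_gen _ _
    cases h with
    | mul p A B => simp only [map_mul, key]; rw [← map_mul]; exact quot_rel (.mul _ _ _)
    | add p A B => simp only [map_add, key]; rw [← map_add]; exact quot_rel (.add _ _ _)
    | smul p c A => simp only [map_smul, key]; rw [← map_smul]; exact quot_rel (.smul _ _ _)
    | one p => simp only [map_one, key]; rw [← map_one (quot N)]; exact quot_rel (.one _)
    | zero p => simp only [map_zero, key]; rw [← map_zero (quot N)]; exact quot_rel (.zero _)
    | isotony h p A =>
      simp only [key]; rw [← SimplexPath.comp_assoc]; exact quot_rel (.isotony h _ _)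
    | homotopy h A => simp only [key]; exact quot_rel (.homotopy (.comp (.refl r) h) _))

theorem pushAlgHom_symb {o' : K} (r : SimplexPath K o o') {a : K} (p : SimplexPath K a o)
    (A : N.fibre a) : pushAlgHom N r (symb p A) = symb (r.comp p) A :=
  (lift_quot _ _ _).trans (FreeStarAlg.lift_gen _ _)

/-- The map `(p, A) ↦ (r * p, A)` for a path `r : o → o'`. -/
def push {o' : K} (r : SimplexPath K o o') : N.EnvAlg o →⋆ₐ[ℂ] N.EnvAlg o' where
  __ := pushAlgHom N r
  map_star' W := by
    change pushAlgHom N r (star W) = star (pushAlgHom N r W)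
    induction W using EnvAlg.induction with
    | h₁ c => rw [star_algebraMap, AlgHom.commutes, AlgHom.commutes, star_algebraMap]
    | h₂ p A => rw [star_symb, pushAlgHom_symb, pushAlgHom_symb, star_symb]
    | h₃ a b ha hb => rw [star_mul, map_mul, map_mul, star_mul, ha, hb]
    | h₄ a b ha hb => rw [star_add, map_add, map_add, star_add, ha, hb]

theorem push_symb {o' : K} (r : SimplexPath K o o') {a : K} (p : SimplexPath K a o)
    (A : N.fibre a) : push N r (symb p A) = symb (r.comp p) A := pushAlgHom_symb N r p A

theorem push_push {o' o'' : K} (s : SimplexPath K o' o'') (r : SimplexPath K o o')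
    (W : N.EnvAlg o) : push N s (push N r W) = push N (s.comp r) W := by
  induction W using EnvAlg.induction with
  | h₁ c => simp only [AlgHomClass.commutes]
  | h₂ p A => simp only [push_symb, SimplexPath.comp_assoc]
  | h₃ a b ha hb => simp only [map_mul, ha, hb]
  | h₄ a b ha hb => simp only [map_add, ha, hb]

theorem push_homotopic {o' : K} {r s : SimplexPath K o o'} (h : r.Homotopic s)
    (W : N.EnvAlg o) : push N r W = push N s W := by
  induction W using EnvAlg.induction with
  | h₁ c => simp only [AlgHomClass.commutes]
  | h₂ p A => rw [push_symb, push_symb]; exact quot_rel (.homotopy (.comp h (.refl p)) A)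
  | h₃ a b ha hb => simp only [map_mul, ha, hb]
  | h₄ a b ha hb => simp only [map_add, ha, hb]

theorem push_triv (W : N.EnvAlg o) : push N (SimplexPath.triv o) W = W := by
  induction W using EnvAlg.induction with
  | h₁ c => simp only [AlgHomClass.commutes]
  | h₂ p A => rw [push_symb]; exact quot_rel (.homotopy p.triv_comp A)
  | h₃ a b ha hb => rw [map_mul, ha, hb]
  | h₄ a b ha hb => rw [map_add, ha, hb]

/-- The inclusion map `(p, A) ↦ ((o' o) * p, A)` for `o ≤ o'`. -/
def incl {o' : K} (h : o ≤ o') : N.EnvAlg o →⋆ₐ[ℂ] N.EnvAlg o' :=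
  push N (.single (Simplex.ofLE h))

theorem incl_incl {e a o : K} (h₁ : e ≤ a) (h₂ : a ≤ o) (W : N.EnvAlg e) :
    incl N h₂ (incl N h₁ W) = incl N (h₁.trans h₂) W := by
  rw [incl, incl, push_push]
  exact push_homotopic N (.triangle _ _ _ o le_rfl le_rfl h₂) W

theorem incl_surjective {a o : K} (h : a ≤ o) : Function.Surjective (incl N h) := by
  intro W
  refine ⟨push N (SimplexPath.single (Simplex.ofLE h)).opp W, ?_⟩
  rw [incl, push_push, push_homotopic N (SimplexPath.comp_opp _), push_triv]

end EnvAlg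

/-- A morphism from the net bundle of *-algebras formed by the `EnvAlg o` to a net of
C*-algebras over `K`. -/
structure EnvMorphism (B : CStarNet.{u, w} K) where
  app : ∀ o : K, N.EnvAlg o →⋆ₙₐ[ℂ] B.fibre o
  app_incl : ∀ {a o : K} (h : a ≤ o) (W : N.EnvAlg a),
    app o (EnvAlg.incl N h W) = B.incl h (app a W)

/-- The numbers `‖π_o(W)‖`, where `π` runs over the morphisms to C*-net bundles. -/
def envNormSet {o : K} (W : N.EnvAlg o) : Set ℝ :=
  {r | ∃ (B : CStarNet.{u, max u v} K) (_ : B.IsNetBundle) (π : N.EnvMorphism B),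
    r = ‖π.app o W‖}

theorem EnvMorphism.norm_symb_le {N : CStarNet.{u, v} K} {B : CStarNet.{u, w} K}
    (π : N.EnvMorphism B) {a o : K}
    (p : SimplexPath K a o) (A : N.fibre a) : ‖π.app o (EnvAlg.symb p A)‖ ≤ ‖A‖ := by
  let f : N.fibre a →⋆ₙₐ[ℂ] B.fibre o :=
    { toFun := fun A => π.app o (EnvAlg.symb p A)
      map_smul' := fun c A => by
        rw [EnvAlg.symb, EnvAlg.quot_rel (.smul p c A), map_smul, map_smul]; rfl
      map_zero' := by rw [EnvAlg.symb, EnvAlg.quot_rel (.zero p), map_zero, map_zero]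
      map_add' := fun A A' => by
        rw [EnvAlg.symb, EnvAlg.quot_rel (.add p A A'), map_add, map_add]; rfl
      map_mul' := fun A A' => by
        rw [EnvAlg.symb, ← EnvAlg.quot_rel (.mul p A A'), map_mul, map_mul]; rfl
      map_star' := fun A => by rw [← EnvAlg.star_symb, map_star] }
  exact NonUnitalStarAlgHom.norm_apply_le f A

theorem bddAbove_envNormSet {o : K} (W : N.EnvAlg o) : BddAbove (N.envNormSet W) := by
  suffices h : ∃ C : ℝ, ∀ (B : CStarNet.{u, max u v} K) (π : N.EnvMorphism B),
      ‖π.app o W‖ ≤ C by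
    obtain ⟨C, hC⟩ := h
    refine ⟨C, ?_⟩
    rintro _ ⟨B, _, π, rfl⟩
    exact hC B π
  induction W using EnvAlg.induction with
  | h₁ c =>
    refine ⟨‖c • (1 : N.fibre o)‖, fun B π => ?_⟩
    have h : algebraMap ℂ (N.EnvAlg o) c =
        EnvAlg.symb (SimplexPath.triv o) (c • (1 : N.fibre o)) := by
      rw [EnvAlg.symb, EnvAlg.quot_rel (.smul _ _ _), map_smul, EnvAlg.quot_rel (.one _),
        map_one, Algebra.algebraMap_eq_smul_one]
    rw [h]
    exact π.norm_symb_le _ _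
  | h₂ p A => exact ⟨‖A‖, fun B π => π.norm_symb_le p A⟩
  | h₃ a b ha hb =>
    obtain ⟨C, hC⟩ := ha
    obtain ⟨D, hD⟩ := hb
    refine ⟨C * D, fun B π => ?_⟩
    rw [map_mul]
    exact (norm_mul_le _ _).trans (mul_le_mul (hC B π) (hD B π) (norm_nonneg _)
      ((norm_nonneg _).trans (hC B π)))
  | h₄ a b ha hb =>
    obtain ⟨C, hC⟩ := ha
    obtain ⟨D, hD⟩ := hb
    refine ⟨C + D, fun B π => ?_⟩
    rw [map_add]
    exact (norm_add_le _ _).trans (add_le_add (hC B π) (hD B π))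

/-- `‖W‖ = sup_π ‖π_o(W)‖`. -/
def envNorm {o : K} (W : N.EnvAlg o) : ℝ := sSup (N.envNormSet W)

theorem envNorm_nonneg {o : K} (W : N.EnvAlg o) : 0 ≤ N.envNorm W :=
  Real.sSup_nonneg (by rintro _ ⟨B, _, π, rfl⟩; exact norm_nonneg _)

theorem le_envNorm {o : K} (W : N.EnvAlg o) {B : CStarNet.{u, max u v} K} (hB : B.IsNetBundle)
    (π : N.EnvMorphism B) : ‖π.app o W‖ ≤ N.envNorm W :=
  le_csSup (N.bddAbove_envNormSet W) ⟨B, hB, π, rfl⟩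

theorem envNorm_le {o : K} (W : N.EnvAlg o) {C : ℝ} (hC : 0 ≤ C)
    (h : ∀ {B : CStarNet.{u, max u v} K}, B.IsNetBundle → ∀ π : N.EnvMorphism B,
      ‖π.app o W‖ ≤ C) : N.envNorm W ≤ C :=
  Real.sSup_le (by rintro _ ⟨B, hB, π, rfl⟩; exact h hB π) hC

/-- The norm of the enveloping net bundle, as a C*-seminorm. -/
def envSeminorm (o : K) : CStarSeminorm (N.EnvAlg o) where
  toFun W := N.envNorm W
  map_zero' := le_antisymm (N.envNorm_le _ le_rfl fun _ π => by rw [map_zero, norm_zero])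
    (N.envNorm_nonneg _)
  add_le' V W := N.envNorm_le _ (add_nonneg (N.envNorm_nonneg _) (N.envNorm_nonneg _))
    fun hB π => by
      rw [map_add]
      exact (norm_add_le _ _).trans (add_le_add (N.le_envNorm V hB π) (N.le_envNorm W hB π))
  neg' W := by
    refine le_antisymm (N.envNorm_le _ (N.envNorm_nonneg _) fun hB π => ?_)
      (N.envNorm_le _ (N.envNorm_nonneg _) fun hB π => ?_)
    · rw [map_neg, norm_neg]; exact N.le_envNorm W hB π
    · rw [← norm_neg, ← map_neg]; exact N.le_envNorm (-W) hB π
  mul_le' V W := N.envNorm_le _ (mul_nonneg (N.envNorm_nonneg _) (N.envNorm_nonneg _))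
    fun hB π => by
      rw [map_mul]
      exact (norm_mul_le _ _).trans (mul_le_mul (N.le_envNorm V hB π) (N.le_envNorm W hB π)
        (norm_nonneg _) (N.envNorm_nonneg _))
  smul_le' c W := N.envNorm_le _ (mul_nonneg (norm_nonneg _) (N.envNorm_nonneg _))
    fun hB π => by
      rw [map_smul, norm_smul]
      exact mul_le_mul_of_nonneg_left (N.le_envNorm W hB π) (norm_nonneg _)
  star_le' W := N.envNorm_le _ (N.envNorm_nonneg _) fun hB π => by
    rw [map_star, norm_star]; exact N.le_envNorm W hB π
  cstar' W := by
    rw [← sq]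
    refine (Real.le_sqrt (N.envNorm_nonneg W) (N.envNorm_nonneg _)).1 ?_
    refine N.envNorm_le _ (Real.sqrt_nonneg _) fun hB π => Real.le_sqrt_of_sq_le ?_
    rw [sq, ← CStarRing.norm_star_mul_self, ← map_star, ← map_mul]
    exact N.le_envNorm _ hB π

theorem envSeminorm_incl {a o : K} (h : a ≤ o) (W : N.EnvAlg a) :
    (N.envSeminorm o).toFun (EnvAlg.incl N h W) = (N.envSeminorm a).toFun W := by
  have hi : ∀ {B : CStarNet.{u, max u v} K} (π : N.EnvMorphism B),
      ‖π.app o (EnvAlg.incl N h W)‖ = ‖π.app a W‖ := fun {B} π => by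
    rw [π.app_incl]
    exact NonUnitalStarAlgHom.norm_map (B.incl h) (B.incl_injective h) _
  refine le_antisymm (N.envNorm_le _ (N.envNorm_nonneg _) fun hB π => ?_)
      (N.envNorm_le _ (N.envNorm_nonneg _) fun hB π => ?_)
  · rw [hi]; exact N.le_envNorm W hB π
  · rw [← hi]; exact N.le_envNorm _ hB π

/-- The enveloping net bundle of a net of C*-algebras. -/
def enveloping : CStarNet.{u, max u v} K where
  fibre o := (N.envSeminorm o).Compl
  incl h := CStarSeminorm.mapCompl (EnvAlg.incl N h) (N.envSeminorm_incl h)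
  incl_injective h := CStarSeminorm.mapCompl_injective _ _
  incl_incl {e a o} h₁ h₂ x := by
    have hc : ∀ {a o : K} (h : a ≤ o), Continuous
        (CStarSeminorm.mapCompl (EnvAlg.incl N h) (N.envSeminorm_incl h)) := fun h =>
      (AddMonoidHomClass.isometry_of_norm _ (CStarSeminorm.norm_mapCompl _ _)).continuous
    induction x using (N.envSeminorm e).compl_induction with
    | hC => exact isClosed_eq ((hc h₂).comp (hc h₁)) (hc _)
    | h W => simp only [CStarSeminorm.mapCompl_toCompl, EnvAlg.incl_incl]

theorem enveloping_isNetBundle : N.enveloping.IsNetBundle := fun h =>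
  ⟨N.enveloping.incl_injective h,
    CStarSeminorm.mapCompl_surjective _ _ (EnvAlg.incl_surjective N h)⟩

/-- The canonical embedding `ε_o(A) = (ι_o, A)` of the net into its enveloping net bundle. -/
def canonicalEmbedding (o : K) : N.fibre o →⋆ₐ[ℂ] N.enveloping.fibre o where
  toFun A := (N.envSeminorm o).toCompl (EnvAlg.symb (SimplexPath.triv o) A)
  map_one' := by
    rw [EnvAlg.symb, EnvAlg.quot_rel (.one _), map_one]
    exact CStarSeminorm.toCompl_one _
  map_mul' A B := by
    rw [EnvAlg.symb, ← EnvAlg.quot_rel (.mul _ A B), map_mul]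
    exact CStarSeminorm.toCompl_mul _ _ _
  map_zero' := by
    rw [EnvAlg.symb, EnvAlg.quot_rel (.zero _), map_zero]
    exact CStarSeminorm.toCompl_zero _
  map_add' A B := by
    rw [EnvAlg.symb, EnvAlg.quot_rel (.add _ A B), map_add]
    exact CStarSeminorm.toCompl_add _ _ _
  commutes' c := by
    rw [Algebra.algebraMap_eq_smul_one, EnvAlg.symb, EnvAlg.quot_rel (.smul _ c 1), map_smul,
      EnvAlg.quot_rel (.one _), map_one, ← Algebra.algebraMap_eq_smul_one]
    exact CStarSeminorm.toCompl_algebraMap _ c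
  map_star' A := by
    rw [← EnvAlg.star_symb]
    exact (CStarSeminorm.star_toCompl _ _).symm

/-- A net is degenerate if its enveloping net bundle vanishes. -/
def IsDegenerate : Prop := N.enveloping.Vanishes

/-- A net is injective if it is nondegenerate and its canonical embedding into the enveloping
net bundle is a monomorphism, that is, faithful on every fibre. -/
def IsInjective : Prop :=
  ¬ N.IsDegenerate ∧ ∀ o : K, Function.Injective (N.canonicalEmbedding o)

/-! ### Hilbert space representations -/

/-- A Hilbert space representation of the net `N` on the Hilbert space `H`: a family of
representations `π_o` of the fibres on `H`, such that the identity operator of `H` intertwines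
`π_a` and `π_o ∘ ȷ_{oa}` whenever `a ≤ o`. -/
structure HilbertRep (H : Type w) [NormedAddCommGroup H] [InnerProductSpace ℂ H]
    [CompleteSpace H] where
  rep : ∀ o : K, N.fibre o →⋆ₙₐ[ℂ] (H →L[ℂ] H)
  rep_incl : ∀ {a o : K} (h : a ≤ o) (A : N.fibre a), rep o (N.incl h A) = rep a A

/-- A representation vanishes if `π_a(A) = 0` for all `a` and `A`. -/
def HilbertRep.Vanishes {N : CStarNet.{u, v} K} {H : Type w} [NormedAddCommGroup H]
    [InnerProductSpace ℂ H] [CompleteSpace H] (ρ : N.HilbertRep H) : Prop :=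
  ∀ (a : K) (A : N.fibre a), ρ.rep a A = 0

/-- The net has a nontrivial (that is, nonvanishing) Hilbert space representation. -/
def HasNontrivialHilbertRep : Prop :=
  ∃ (H : Type (max u v)) (_ : NormedAddCommGroup H) (_ : InnerProductSpace ℂ H)
    (_ : CompleteSpace H) (ρ : N.HilbertRep H), ¬ ρ.Vanishes

end

end CStarNet

end CStarNets

/-! A representation of the net is a way of forgetting paths. Given unital representations `σ a` of
the fibres that are compatible with the inclusions, sending `(p, A)` to `σ A` respects all relations
of the enveloping bundle and is a morphism to a constant net bundle. Constant bundles take part in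
the supremum that defines the norm, so this map is contractive and extends to the completed fibre
over `o` (`envHom`). The path plays no part in its value, so the extension is invariant under
holonomy (`envHom_holonomy`). Its kernel is then a closed invariant ideal that contains all `A -
α_g(A)`, and it omits the unit as soon as the target is nontrivial. Hence the coinvariant ideal J is
proper (`coinvariantIdeal_ne_top`). A representation of the net need not be unital, but
connectedness makes all its units act as one projection (`HilbertRep.rep_one_eq`), and `compression`
to the range of that projection makes it unital.

Conversely, if J is proper, some state of the fibre vanishes on J (`exists_state_of_ne_top`), and
its GNS representation kills J (`gnsStarAlgHom_eq_zero`). Every fibre of the net can be embedded in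
the enveloping bundle and transported to `o` along a path. Two choices of path differ by a holonomy,
hence by elements of J (`toEnv_symb_sub_mem`), so after the GNS representation the choice is
immaterial and the maps form a representation of the net (`inducedRep`). -/

namespace CStarNets

/-! ### States that vanish on a proper ideal, and their GNS representations. -/

section PositiveFunctional

open scoped ComplexOrder

variable {A : Type v} [CStarAlgebra A]

/-- A functional on a unital C*-algebra with `‖f‖ ≤ 1 = f 1` is real on selfadjoint elements. -/
theorem im_apply_eq_zero_of_isSelfAdjoint (f : A →ₗ[ℂ] ℂ) (hf : ∀ a, ‖f a‖ ≤ ‖a‖) (h1 : f 1 = 1)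
    {a : A} (ha : IsSelfAdjoint a) : (f a).im = 0 := by
  rcases subsingleton_or_nontrivial A with _ | _
  · rw [Subsingleton.elim a 0, map_zero, Complex.zero_im]
  -- Translating `a` by `i t` adds `t` to the imaginary part of `f a`, while the C*-identity bounds
  -- the squared norm by `‖a‖ ^ 2 + t ^ 2`. The terms `t ^ 2` cancel, and a linear function of `t`
  -- remains bounded above.
  have key : ∀ t : ℝ, 2 * (f a).im * t ≤ ‖a‖ ^ 2 := by
    intro t
    have hs : star (a + (t * Complex.I : ℂ) • (1 : A)) * (a + (t * Complex.I : ℂ) • (1 : A)) =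
        a * a + ((t : ℂ) ^ 2) • (1 : A) := by
      have hc : star (t * Complex.I : ℂ) = -(t * Complex.I) := by simp
      have hI : -(t * Complex.I) * (t * Complex.I) = (t : ℂ) ^ 2 := by
        linear_combination (-(t : ℂ) ^ 2) * Complex.I_sq
      rw [star_add, star_smul, star_one, ha.star_eq, hc, add_mul, mul_add, mul_add,
        smul_mul_smul_comm, hI, mul_one, mul_smul_comm, smul_mul_assoc, mul_one, one_mul, neg_smul]
      abel
    have hn : ‖a + (t * Complex.I : ℂ) • (1 : A)‖ ^ 2 ≤ ‖a‖ ^ 2 + t ^ 2 := by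
      rw [sq, ← CStarRing.norm_star_mul_self, hs]
      refine (norm_add_le _ _).trans (add_le_add ((norm_mul_le _ _).trans_eq (sq _).symm) ?_)
      rw [norm_smul, norm_one, mul_one, norm_pow, Complex.norm_real, Real.norm_eq_abs, sq_abs]
    have hv := (pow_le_pow_left₀ (norm_nonneg _) (hf (a + (t * Complex.I : ℂ) • (1 : A))) 2).trans hn
    rw [map_add, map_smul, h1, Complex.sq_norm, Complex.normSq_apply] at hv
    simp at hv
    nlinarith [sq_nonneg (f a).re, sq_nonneg (f a).im]
  by_contra h
  -- For this `t` the left side of `key` equals `‖a‖ ^ 2 + 1`.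
  have := key ((‖a‖ ^ 2 + 1) / (2 * (f a).im))
  rw [mul_div_cancel₀ _ (by simpa using h)] at this
  linarith

variable [PartialOrder A] [StarOrderedRing A]

/-- A functional on a unital C*-algebra with `‖f‖ ≤ 1 = f 1` is positive. -/
theorem nonneg_apply_of_nonneg (f : A →ₗ[ℂ] ℂ) (hf : ∀ a, ‖f a‖ ≤ ‖a‖) (h1 : f 1 = 1)
    {a : A} (ha : 0 ≤ a) : 0 ≤ f a := by
  rw [Complex.nonneg_iff]
  refine ⟨?_, (im_apply_eq_zero_of_isSelfAdjoint f hf h1 (IsSelfAdjoint.of_nonneg ha)).symm⟩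
  have hle : a ≤ algebraMap ℝ A ‖a‖ := IsSelfAdjoint.le_algebraMap_norm_self
  -- From `0 ≤ ‖a‖ - a ≤ ‖a‖`. Applying `f` gives `‖a‖ - Re (f a) ≤ ‖a‖`, which is the required
  -- sign.
  have hn : ‖algebraMap ℝ A ‖a‖ - a‖ ≤ ‖a‖ := by
    rw [CStarAlgebra.norm_le_iff_le_algebraMap _ (norm_nonneg a) (sub_nonneg.2 hle)]
    exact sub_le_self _ ha
  have hv : f (algebraMap ℝ A ‖a‖ - a) = (‖a‖ : ℂ) - f a := by
    rw [map_sub, IsScalarTower.algebraMap_apply ℝ ℂ A, Algebra.algebraMap_eq_smul_one, map_smul, h1]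
    simp
  have h := (Complex.re_le_norm _).trans ((hf _).trans hn)
  rw [hv] at h
  simp at h
  exact h

/-- A proper ideal of a unital C*-algebra is annihilated by a state. -/
theorem exists_state_of_ne_top (I : TwoSidedIdeal A) (hI : I ≠ ⊤) :
    ∃ f : A →ₚ[ℂ] ℂ, f 1 = 1 ∧ ∀ x ∈ I, f x = 0 := by
  have h1 : (1 : A) ∉ I := fun h => hI (I.one_mem_iff.1 h)
  have : Nontrivial A := ⟨1, 0, fun h => h1 (h ▸ I.zero_mem)⟩
  let S : Submodule ℂ A :=
    { carrier := I
      add_mem' := I.add_mem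
      zero_mem' := I.zero_mem
      smul_mem' := fun c x hx => by
        rw [Algebra.smul_def]; exact I.mul_mem_left _ _ hx }
  -- If the class of `1` had norm below 1, a representative `m` with `‖m‖ < 1` would make `1 - m` an
  -- invertible element of `I`. With norm exactly 1, Hahn–Banach on the quotient yields a functional
  -- of norm 1 with value 1 at the unit, which is a state.
  have hnorm : ‖S.mkQ 1‖ = 1 := by
    refine le_antisymm ((Submodule.Quotient.norm_mk_le S 1).trans_eq norm_one) ?_
    by_contra! h
    obtain ⟨m, hm, hlt⟩ := Submodule.Quotient.norm_mk_lt (S := S) (S.mkQ 1) (sub_pos.2 h)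
    rw [add_sub_cancel] at hlt
    have hmem : 1 - m ∈ I := (Submodule.Quotient.eq S).1 hm.symm
    obtain ⟨v, hv⟩ := (isUnit_one_sub_of_norm_lt_one hlt).exists_left_inv
    exact h1 (hv ▸ I.mul_mem_left v _ hmem)
  obtain ⟨g, hg, hg1⟩ := exists_dual_vector ℂ (S.mkQ 1) (by rw [hnorm]; exact one_ne_zero)
  have hb : ∀ a, ‖(g.toLinearMap ∘ₗ S.mkQ) a‖ ≤ ‖a‖ := fun a => by
    refine (g.le_opNorm _).trans ?_
    rw [hg, one_mul]
    exact Submodule.Quotient.norm_mk_le S a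
  have hone : (g.toLinearMap ∘ₗ S.mkQ) 1 = 1 := by
    refine hg1.trans ?_
    rw [hnorm]; simp
  refine ⟨PositiveLinearMap.mk₀ (g.toLinearMap ∘ₗ S.mkQ)
    fun a ha => nonneg_apply_of_nonneg _ hb hone ha, hone, fun x hx => ?_⟩
  have hx0 : S.mkQ x = 0 := (Submodule.Quotient.mk_eq_zero S).2 hx
  change g (S.mkQ x) = 0
  rw [hx0, map_zero]

open UniformSpace in
/-- The GNS representation of a state annihilates every ideal that the state annihilates. -/
theorem gnsStarAlgHom_eq_zero (f : A →ₚ[ℂ] ℂ) (I : TwoSidedIdeal A) (hf : ∀ x ∈ I, f x = 0)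
    {x : A} (hx : x ∈ I) : f.gnsStarAlgHom x = 0 := by
  ext b
  induction b using Completion.induction_on with
  | hp => apply isClosed_eq <;> fun_prop
  | ih b =>
    change f.gnsNonUnitalStarAlgHom x b = 0
    rw [PositiveLinearMap.gnsNonUnitalStarAlgHom_apply_coe, ← norm_eq_zero,
      Completion.norm_coe, PositiveLinearMap.preGNS_norm_def]
    -- The squared norm of the vector `x b` is `f ((x b)* (x b))`, and the argument lies in the
    -- two-sided ideal `I`.
    have h : f (star (x * f.ofPreGNS b) * (x * f.ofPreGNS b)) = 0 :=
      hf _ (I.mul_mem_left _ _ (I.mul_mem_right _ _ hx))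
    rw [PositiveLinearMap.leftMulMapPreGNS_apply, PositiveLinearMap.ofPreGNS_toPreGNS, h]
    simp

/-- The class of the unit is a vector of squared norm `f 1 = 1`. -/
theorem nontrivial_gns (f : A →ₚ[ℂ] ℂ) (h1 : f 1 = 1) : Nontrivial f.GNS := by
  refine ⟨(f.toPreGNS 1 : f.GNS), 0, fun h => ?_⟩
  rw [← norm_eq_zero, UniformSpace.Completion.norm_coe, PositiveLinearMap.preGNS_norm_def] at h
  simp [h1] at h

end PositiveFunctional

/-! ### Making a representation unital. -/

section Compression

variable {A : Type v} [CStarAlgebra A] {H : Type w} [NormedAddCommGroup H]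
  [InnerProductSpace ℂ H] [CompleteSpace H]

/-- A representation `f` of a unital C*-algebra, restricted to the range `U` of the projection
`f 1`. -/
noncomputable def compression (f : A →⋆ₙₐ[ℂ] (H →L[ℂ] H)) (U : Submodule ℂ H)
    [CompleteSpace U] (hU : f 1 = U.starProjection) : A →⋆ₐ[ℂ] (U →L[ℂ] U) :=
  have h1 : U.orthogonalProjectionOnto ∘L f 1 ∘L U.subtypeL = 1 := by
    ext x
    simp [hU]
  { toFun := fun a => U.orthogonalProjectionOnto ∘L f a ∘L U.subtypeL
    map_one' := h1
    map_mul' := fun a b => by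
      -- The unit of `A` is inserted between the factors. Since `f 1` is the projection to `U`
      -- followed by the inclusion of `U`, the product then splits into two compressions.
      have h : f a * f b = f a * U.starProjection * f b := by
        rw [← hU, ← map_mul f a 1, mul_one]
      rw [map_mul, h]
      rfl
    map_zero' := by simp
    map_add' := fun a b => by ext; simp
    commutes' := fun c => by
      rw [Algebra.algebraMap_eq_smul_one, Algebra.algebraMap_eq_smul_one, map_smul, ← h1]
      ext; simp
    map_star' := fun a => by
      rw [map_star, ContinuousLinearMap.star_eq_adjoint, ContinuousLinearMap.star_eq_adjoint,
        ContinuousLinearMap.adjoint_comp, ContinuousLinearMap.adjoint_comp,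
        Submodule.adjoint_orthogonalProjectionOnto, Submodule.adjoint_subtypeL]
      rfl }

end Compression

/-! ### The coinvariant ideal. -/

theorem sub_mem_coinvariantIdeal {A : Type v} {G : Type u} [CStarAlgebra A] [Group G]
    (α : G →* (A ≃⋆ₐ[ℂ] A)) (g : G) (a : A) : a - α g a ∈ coinvariantIdeal α :=
  (TwoSidedIdeal.mem_sInf _).2 fun _ hI => hI.2.2 g a

theorem coinvariantIdeal_le {A : Type v} {G : Type u} [CStarAlgebra A] [Group G]
    (α : G →* (A ≃⋆ₐ[ℂ] A)) {I : TwoSidedIdeal A} (hI : IsClosed {x : A | x ∈ I})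
    (hα : ∀ g : G, ∀ x ∈ I, α g x ∈ I) (hsub : ∀ (g : G) (a : A), a - α g a ∈ I) :
    coinvariantIdeal α ≤ I :=
  sInf_le ⟨hI, hα, hsub⟩

/-- An invariant continuous ring homomorphism to a nontrivial ring forces the ideal `J^G_A` to be
proper. -/
theorem coinvariantIdeal_ne_top {A : Type v} {G : Type u} [CStarAlgebra A] [Group G]
    (α : G →* (A ≃⋆ₐ[ℂ] A)) {B : Type w} [Ring B] [TopologicalSpace B] [T1Space B] [Nontrivial B]
    (f : A →+* B) (hf : Continuous f) (hα : ∀ g a, f (α g a) = f a) :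
    coinvariantIdeal α ≠ ⊤ := by
  intro h
  -- The kernel competes in the infimum: it is closed because points of `B` are closed, and both
  -- algebraic conditions follow from the invariance of `f`.
  have hle : coinvariantIdeal α ≤ TwoSidedIdeal.ker f := by
    refine coinvariantIdeal_le α ?_ (fun g x hx => ?_) (fun g a => ?_)
    · simp only [TwoSidedIdeal.mem_ker]
      exact isClosed_singleton.preimage hf
    · rw [TwoSidedIdeal.mem_ker] at hx ⊢
      rw [hα, hx]
    · rw [TwoSidedIdeal.mem_ker, map_sub, hα, sub_self]
  have h1 : (1 : A) ∈ TwoSidedIdeal.ker f := hle (h ▸ TwoSidedIdeal.mem_top A)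
  rw [TwoSidedIdeal.mem_ker, map_one] at h1
  exact one_ne_zero h1

namespace CStarNet

variable {K : Type u} [PartialOrder K] (N : CStarNet.{u, v} K)

/-! ### Paths acting on the enveloping net bundle -/

/-- The image of `W` in the enveloping net bundle. -/
noncomputable def toEnv {o : K} (W : N.EnvAlg o) : N.enveloping.fibre o :=
  (N.envSeminorm o).toCompl W

theorem incl_toEnv {a o : K} (h : a ≤ o) (W : N.EnvAlg a) :
    N.enveloping.incl h (N.toEnv W) = N.toEnv (EnvAlg.incl N h W) :=
  CStarSeminorm.mapCompl_toCompl _ _ W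

/-- Holonomy in the completed bundle, defined by inverting inclusions, thus becomes concatenation of
paths on symbols, where homotopies can be used directly. -/
theorem holPath_toEnv {a o : K} (p : SimplexPath K a o) (W : N.EnvAlg a) :
    N.enveloping.holPath N.enveloping_isNetBundle p (N.toEnv W) =
      N.toEnv (EnvAlg.push N p W) := by
  have hb : ∀ {a o : K} (b : Simplex K a o) (W : N.EnvAlg a),
      N.enveloping.holSimplex N.enveloping_isNetBundle b (N.toEnv W) =
        N.toEnv (EnvAlg.push N (.single b) W) := by
    intro a o b W
    -- It suffices to compare in the fibre over `|b|`. There the path `(|b| o) * b` is homotopic to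
    -- `(|b| a)`, by a 2-simplex with support `|b|`.
    apply N.enveloping.incl_injective b.le_end
    rw [incl_holSimplex, incl_toEnv, incl_toEnv, EnvAlg.incl, EnvAlg.incl, EnvAlg.push_push]
    exact congrArg N.toEnv (EnvAlg.push_homotopic N
      (.symm (.triangle (Simplex.ofLE b.le_end) (Simplex.ofLE b.le_start) b b.supp
        le_rfl le_rfl le_rfl)) W)
  induction p with
  | single b => exact hb b W
  | cons b p ih =>
    refine (congrArg (N.enveloping.holSimplex N.enveloping_isNetBundle b) ih).trans ?_
    rw [hb, EnvAlg.push_push]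
    rfl

theorem holPath_canonicalEmbedding {a o : K} (p : SimplexPath K a o) (A : N.fibre a) :
    N.enveloping.holPath N.enveloping_isNetBundle p (N.canonicalEmbedding a A) =
      N.toEnv (EnvAlg.symb p A) := by
  refine (N.holPath_toEnv p _).trans (congrArg N.toEnv ?_)
  rw [EnvAlg.push_symb]
  exact EnvAlg.quot_rel (.homotopy p.comp_triv A)

theorem toEnv_symb_incl {a a' o : K} (h : a ≤ a') (p : SimplexPath K a' o) (A : N.fibre a) :
    N.toEnv (EnvAlg.symb p (N.incl h A)) =
      N.toEnv (EnvAlg.symb (p.comp (.single (Simplex.ofLE h))) A) :=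
  congrArg N.toEnv (EnvAlg.quot_rel (.isotony h p A))

/-- The path `q` is homotopic to `(q * p.opp) * p`, and the bracket is a loop over `o`. -/
theorem toEnv_symb_eq_holonomy {a o : K} (p q : SimplexPath K a o) (A : N.fibre a) :
    N.toEnv (EnvAlg.symb q A) = N.enveloping.holonomy N.enveloping_isNetBundle o
      (FundGroup.mk (q.comp p.opp)) (N.toEnv (EnvAlg.symb p A)) := by
  refine Eq.trans (congrArg N.toEnv ?_) (N.holPath_toEnv (q.comp p.opp) (EnvAlg.symb p A)).symm
  rw [EnvAlg.push_symb, SimplexPath.comp_assoc]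
  exact EnvAlg.quot_rel (.homotopy
    (.symm ((SimplexPath.Homotopic.comp (.refl q) p.opp_comp).trans q.comp_triv)) A)

/-! ### From an invariant representation of the fibre to a representation of the net -/

theorem toEnv_symb_sub_mem {a o : K} (p q : SimplexPath K a o) (A : N.fibre a) :
    N.toEnv (EnvAlg.symb p A) - N.toEnv (EnvAlg.symb q A) ∈
      coinvariantIdeal (N.enveloping.holonomy N.enveloping_isNetBundle o) := by
  rw [N.toEnv_symb_eq_holonomy p q]
  exact sub_mem_coinvariantIdeal _ _ _

/-- A representation of the fibre over `o` of the enveloping net bundle that annihilates the ideal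
`J` induces a representation of the net. -/
noncomputable def inducedRep (hK : IsPathwiseConnected K) {o : K} {H : Type w}
    [NormedAddCommGroup H] [InnerProductSpace ℂ H] [CompleteSpace H]
    (π : N.enveloping.fibre o →⋆ₐ[ℂ] (H →L[ℂ] H))
    (hπ : ∀ x ∈ coinvariantIdeal (N.enveloping.holonomy N.enveloping_isNetBundle o), π x = 0) :
    N.HilbertRep H where
  rep a := ((π.comp (StarAlgHomClass.toStarAlgHom
    (N.enveloping.holPath N.enveloping_isNetBundle (hK a o).some))).comp
      (N.canonicalEmbedding a)).toNonUnitalStarAlgHom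
  rep_incl {a a'} h A := by
    change π (N.enveloping.holPath _ _ (N.canonicalEmbedding a' (N.incl h A))) =
      π (N.enveloping.holPath _ _ (N.canonicalEmbedding a A))
    -- By isotony both sides come from symbols of the same `A`, along two paths from `a` to `o`: the
    -- one chosen for `a`, and the one chosen for `a'` preceded by `(a' a)`. Their difference lies
    -- in J, which `π` annihilates.
    rw [holPath_canonicalEmbedding, holPath_canonicalEmbedding, toEnv_symb_incl, ← sub_eq_zero,
      ← map_sub]
    exact hπ _ (N.toEnv_symb_sub_mem _ _ A)

theorem inducedRep_one (hK : IsPathwiseConnected K) {o : K} {H : Type w}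
    [NormedAddCommGroup H] [InnerProductSpace ℂ H] [CompleteSpace H]
    (π : N.enveloping.fibre o →⋆ₐ[ℂ] (H →L[ℂ] H))
    (hπ : ∀ x ∈ coinvariantIdeal (N.enveloping.holonomy N.enveloping_isNetBundle o), π x = 0)
    (a : K) : (N.inducedRep hK π hπ).rep a 1 = 1 := by
  change π (N.enveloping.holPath _ _ (N.canonicalEmbedding a 1)) = 1
  simp only [map_one]

theorem hasNontrivialHilbertRep_of_ne_top (hK : IsPathwiseConnected K) (o : K)
    (h : coinvariantIdeal (N.enveloping.holonomy N.enveloping_isNetBundle o) ≠ ⊤) :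
    N.HasNontrivialHilbertRep := by
  -- Positive functionals refer to an order on the algebra; the spectral order is introduced here
  -- for that purpose.
  let _ : PartialOrder (N.enveloping.fibre o) := CStarAlgebra.spectralOrder _
  let _ : StarOrderedRing (N.enveloping.fibre o) := CStarAlgebra.spectralOrderedRing _
  obtain ⟨f, h1, hf⟩ := exists_state_of_ne_top _ h
  have := nontrivial_gns f h1
  refine ⟨f.GNS, inferInstance, inferInstance, inferInstance,
    N.inducedRep hK f.gnsStarAlgHom fun x hx => gnsStarAlgHom_eq_zero f _ hf hx, fun hv => ?_⟩
  have h0 := hv o 1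
  rw [inducedRep_one] at h0
  exact one_ne_zero h0

/-! ### From a representation of the net to an invariant representation of the fibre -/

/-- The constant net bundle. -/
def const (K : Type u) [PartialOrder K] (B : Type w) [CStarAlgebra B] : CStarNet.{u, w} K where
  fibre _ := B
  incl _ := StarAlgHom.id ℂ B
  incl_injective _ := Function.injective_id
  incl_incl _ _ _ := rfl

theorem const_isNetBundle (B : Type w) [CStarAlgebra B] : (const K B).IsNetBundle :=
  fun _ => Function.bijective_id

/-! ### Morphisms to constant net bundles. -/

section ConstMorphism

variable {N} {B : Type w} [CStarAlgebra B]

/-- The algebra homomorphism `(p, A) ↦ σ A`, for a family `σ` of unital representations of the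
fibres that is compatible with the inclusion maps. -/
noncomputable def constAlgHom (σ : ∀ a : K, N.fibre a →⋆ₐ[ℂ] B)
    (hσ : ∀ {a a' : K} (h : a ≤ a') (A : N.fibre a), σ a' (N.incl h A) = σ a A) (o : K) :
    N.EnvAlg o →ₐ[ℂ] B :=
  EnvAlg.lift (FreeStarAlg.lift fun x => σ x.src x.elt) (by
    intro x y h
    have key : ∀ {a : K} (p : SimplexPath K a o) (A : N.fibre a),
        FreeStarAlg.lift (fun x : N.EnvGen o => σ x.src x.elt) (envSymb p A) = σ a A :=
      fun p A => FreeStarAlg.lift_gen _ _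
    cases h with
    | mul p A B => simp only [map_mul, key]
    | add p A B => simp only [map_add, key]
    | smul p c A => simp only [map_smul, key]
    | one p => simp only [map_one, key]
    | zero p => simp only [map_zero, key]
    | isotony h p A => simp only [key, hσ]
    | homotopy h A => simp only [key])

variable (σ : ∀ a : K, N.fibre a →⋆ₐ[ℂ] B)
  (hσ : ∀ {a a' : K} (h : a ≤ a') (A : N.fibre a), σ a' (N.incl h A) = σ a A)

theorem constAlgHom_symb {a o : K} (p : SimplexPath K a o) (A : N.fibre a) :
    constAlgHom σ hσ o (EnvAlg.symb p A) = σ a A :=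
  (EnvAlg.lift_quot _ _ _).trans (FreeStarAlg.lift_gen _ _)

/-- Pushing along `r` alters only the path of a symbol, which the map ignores. With `r` the simplex
of an inclusion this gives a morphism of bundles; with `r` a loop it gives invariance under
holonomy. -/
theorem constAlgHom_push {o o' : K} (r : SimplexPath K o o') (W : N.EnvAlg o) :
    constAlgHom σ hσ o' (EnvAlg.push N r W) = constAlgHom σ hσ o W := by
  induction W using EnvAlg.induction with
  | h₁ c => simp only [AlgHomClass.commutes]
  | h₂ p A => rw [EnvAlg.push_symb, constAlgHom_symb, constAlgHom_symb]
  | h₃ a b ha hb => simp only [map_mul, ha, hb]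
  | h₄ a b ha hb => simp only [map_add, ha, hb]

theorem constAlgHom_star {o : K} (W : N.EnvAlg o) :
    constAlgHom σ hσ o (star W) = star (constAlgHom σ hσ o W) := by
  induction W using EnvAlg.induction with
  | h₁ c => rw [EnvAlg.star_algebraMap, AlgHom.commutes, AlgHom.commutes, algebraMap_star_comm]
  | h₂ p A => rw [EnvAlg.star_symb, constAlgHom_symb, constAlgHom_symb, map_star]
  | h₃ a b ha hb => rw [star_mul, map_mul, map_mul, star_mul, ha, hb]
  | h₄ a b ha hb => rw [star_add, map_add, map_add, star_add, ha, hb]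

/-- The morphism `(p, A) ↦ σ A` to the constant net bundle. -/
noncomputable def constMorphism : N.EnvMorphism (const K B) where
  app o :=
    { toFun := constAlgHom σ hσ o
      map_smul' := map_smul _
      map_zero' := map_zero _
      map_add' := map_add _
      map_mul' := map_mul _
      map_star' := constAlgHom_star σ hσ }
  app_incl _ W := constAlgHom_push σ hσ _ W

end ConstMorphism

/-! ### Extension to the completed fibre. -/

section EnvHom

variable {N} {B : Type (max u v)} [CStarAlgebra B] (σ : ∀ a : K, N.fibre a →⋆ₐ[ℂ] B)
  (hσ : ∀ {a a' : K} (h : a ≤ a') (A : N.fibre a), σ a' (N.incl h A) = σ a A)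

/-- The constant bundle is one of the bundles in the supremum defining the norm. Since those bundles
have fibres in `Type (max u v)`, so must `B`. -/
theorem norm_constAlgHom_le {o : K} (W : N.EnvAlg o) :
    ‖constAlgHom σ hσ o W‖ ≤ (N.envSeminorm o).toFun W :=
  N.le_envNorm W (const_isNetBundle B) (constMorphism σ hσ)

theorem continuous_constAlgHom (o : K) :
    Continuous (show (N.envSeminorm o).Carrier →+* B from (constAlgHom σ hσ o).toRingHom) :=
  AddMonoidHomClass.continuous_of_bound _ 1 fun W => by
    rw [one_mul]; exact norm_constAlgHom_le σ hσ W

/-- The extension of `(p, A) ↦ σ A` to the fibre of the enveloping net bundle. -/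
noncomputable def envHom (o : K) : N.enveloping.fibre o →+* B :=
  UniformSpace.Completion.extensionHom
    (show (N.envSeminorm o).Carrier →+* B from (constAlgHom σ hσ o).toRingHom)
    (continuous_constAlgHom σ hσ o)

theorem continuous_envHom (o : K) : Continuous (envHom σ hσ o) :=
  UniformSpace.Completion.continuous_extension

theorem envHom_toEnv {o : K} (W : N.EnvAlg o) :
    envHom σ hσ o (N.toEnv W) = constAlgHom σ hσ o W :=
  UniformSpace.Completion.extensionHom_coe _ (continuous_constAlgHom σ hσ o) W

/-- Both sides are continuous in `x`, and on the dense image of the symbols holonomy is a push along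
a loop. -/
theorem envHom_holonomy {o : K} (g : FundGroup K o) (x : N.enveloping.fibre o) :
    envHom σ hσ o (N.enveloping.holonomy N.enveloping_isNetBundle o g x) = envHom σ hσ o x := by
  obtain ⟨p⟩ := g
  have hp : Continuous (N.enveloping.holPath N.enveloping_isNetBundle p) :=
    (AddMonoidHomClass.isometry_of_norm _ fun x => StarAlgEquiv.norm_map _ x).continuous
  change envHom σ hσ o (N.enveloping.holPath N.enveloping_isNetBundle p x) = _
  induction x using (N.envSeminorm o).compl_induction with
  | hC =>
    exact isClosed_eq ((continuous_envHom σ hσ o).comp hp) (continuous_envHom σ hσ o)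
  | h W =>
    change envHom σ hσ o (N.enveloping.holPath N.enveloping_isNetBundle p (N.toEnv W)) =
      envHom σ hσ o (N.toEnv W)
    rw [holPath_toEnv, envHom_toEnv, envHom_toEnv, constAlgHom_push]

end EnvHom

-- The inclusions are unital, so the units over both ends of a simplex act as the unit over its
-- support.
variable {N} in
theorem HilbertRep.rep_one_eq {H : Type w} [NormedAddCommGroup H] [InnerProductSpace ℂ H]
    [CompleteSpace H] (ρ : N.HilbertRep H) {a o : K} (p : SimplexPath K a o) :
    ρ.rep a 1 = ρ.rep o 1 := by
  have hb : ∀ {a o : K} (_ : Simplex K a o), ρ.rep a 1 = ρ.rep o 1 := fun b => by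
    rw [← ρ.rep_incl b.le_start, ← ρ.rep_incl b.le_end, map_one (N.incl _),
      map_one (N.incl _)]
  induction p with
  | single b => exact hb b
  | cons b p ih => exact ih.trans (hb b)

theorem ne_top_of_hasNontrivialHilbertRep (hK : IsPathwiseConnected K) (o : K)
    (h : N.HasNontrivialHilbertRep) :
    coinvariantIdeal (N.enveloping.holonomy N.enveloping_isNetBundle o) ≠ ⊤ := by
  obtain ⟨H, _, _, _, ρ, hρ⟩ := h
  -- The unit acts as a projection, by connectedness the same one over every element of `K`. Its
  -- range `U` carries unital representations of all fibres.
  have hP : IsStarProjection (ρ.rep o 1) :=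
    ⟨by rw [IsIdempotentElem, ← map_mul, mul_one],
      by rw [IsSelfAdjoint, ← map_star, star_one]⟩
  obtain ⟨U, _, hU⟩ := isStarProjection_iff_eq_starProjection.1 hP
  have hU' : ∀ a, ρ.rep a 1 = U.starProjection := fun a =>
    (ρ.rep_one_eq (hK a o).some).trans hU
  have hUc : CompleteSpace U :=
    (U.orthogonal_orthogonal ▸ Uᗮ.isClosed_orthogonal).completeSpace_coe
  -- If `U` were zero, then `ρ(A) = ρ(A) ρ(1) = 0` for every `A`, so `ρ` would vanish.
  have hne : Nontrivial U := by
    by_contra hn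
    rw [Submodule.nontrivial_iff_ne_bot, not_not] at hn
    refine hρ fun a A => ?_
    subst hn
    rw [← mul_one A, map_mul, hU', Submodule.starProjection_bot, mul_zero]
  exact coinvariantIdeal_ne_top _
    (envHom (B := U →L[ℂ] U) (fun a => compression (ρ.rep a) U (hU' a)) (fun {a a'} h A => by
      ext x
      simp only [compression, StarAlgHom.coe_mk, ρ.rep_incl]) o)
    (continuous_envHom _ _ o) (envHom_holonomy _ _)

end CStarNet

end CStarNets

theorem mainTheorem9 {K : Type u} [PartialOrder K] [Nonempty K]
    (hK : CStarNets.IsPathwiseConnected K)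
    (N : CStarNets.CStarNet.{u, v} K) (hN : N.IsInjective) (o : K) :
    N.HasNontrivialHilbertRep ↔
      CStarNets.coinvariantIdeal (N.enveloping.holonomy N.enveloping_isNetBundle o) ≠ ⊤ :=
  ⟨N.ne_top_of_hasNontrivialHilbertRep hK o, N.hasNontrivialHilbertRep_of_ne_top hK o⟩
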